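/- Let $\mathcal H^A,\mathcal H^B,\mathcal H^C$ be complex Hilbert spaces of the same finite dimension $d$, with scalar products linear in the second argument, and let $\psi\in\mathcal H^A\otimes\mathcal H^B$ and $\varphi\in\mathcal H^B\otimes\mathcal H^C$ be vectors (not necessarily normalized) of maximal Schmidt rank, i.e. each has a Schmidt decomposition $\sum_{j=1}^{d}\sqrt{p_j}\,a_j\otimes b_j$ with all $p_j>0$ and $(a_j)$, $(b_j)$ orthonormal. Let $s^{ba}_\psi:\mathcal H^A\to\mathcal H^B$ and $s^{ab}_\psi:\mathcal H^B\to\mathcal H^A$ be the antilinear maps defined by $$(|x\rangle\langle x|\otimes 1)\,\psi=x\otimes s^{ba}_\psi x,\qquad (1\otimes|y\rangle\langle y|)\,\psi=s^{ab}_\psi y\otimes y,$$ so that $s^{ba}_{a\otimes b}\,x=\langle x,a\rangle\,b$ and $s^{ab}_{a\otimes b}\,y=\langle y,b\rangle\,a$, and define $s^{cb}_\varphi:\mathcal H^B\to\mathcal H^C$ and $s^{bc}_\varphi:\mathcal H^C\to\mathcal H^B$ in the same way from $\varphi$. Let $$t^{ca}:=s^{cb}_\varphi s^{ba}_\psi:\mathcal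 H^A\to\mathcal H^C,\qquad t^{ac}:=s^{ab}_\psi s^{bc}_\varphi:\mathcal H^C\to\mathcal H^A$$ be the (linear) teleportation maps, and let $\rho_\psi=\mathrm{Tr}_A|\psi\rangle\langle\psi|$ and $\rho_\varphi=\mathrm{Tr}_C|\varphi\rangle\langle\varphi|$ be the reductions to $\mathcal H^B$. Then $(t^{ca})^\dagger=t^{ac}$, and the singular values of $t^{ca}$ and those of $t^{ac}$, counted with multiplicity, both coincide with the eigenvalues of $(\sqrt{\rho_\psi}\,\rho_\varphi\sqrt{\rho_\psi})^{1/2}$, counted with multiplicity. Hence, with $\|T\|_1:=\mathrm{tr}\,(T^\dagger T)^{1/2}$, $$\|t^{ca}\|_1=\|t^{ac}\|_1=\mathrm{tr}\,(\sqrt{\rho_\psi}\,\rho_\varphi\sqrt{\rho_\psi})^{1/2}=:F(\rho_\psi,\rho_\varphi).$$ -/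

import Mathlib

open scoped TensorProduct

noncomputable section

namespace Teleportation

section Vectors

variable {A B C : Type*}
  [NormedAddCommGroup A] [InnerProductSpace ℂ A]
  [NormedAddCommGroup B] [InnerProductSpace ℂ B]
  [NormedAddCommGroup C] [InnerProductSpace ℂ C]

/-- The antilinear map `s_ψ^{ba} : A → B` of a bipartite vector `ψ ∈ A ⊗ B`. On a product vector
`ψ = a ⊗ b` it is `x ↦ ⟨x, a⟩ b`; see `proj_tensor_one_apply` for the defining property
`(|x⟩⟨x| ⊗ 1) ψ = x ⊗ s_ψ^{ba} x`. -/
def sBA (ψ : A ⊗[ℂ] B) : A →ₗ⋆[ℂ] B where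
  toFun x := TensorProduct.lid ℂ B ((innerₛₗ ℂ x).rTensor B ψ)
  map_add' x y := by rw [map_add, LinearMap.rTensor_add, LinearMap.add_apply, map_add]
  map_smul' c x := by
    rw [map_smulₛₗ, LinearMap.rTensor_smul, LinearMap.smul_apply, map_smul]

/-- The antilinear map `s_ψ^{ab} : B → A` of a bipartite vector `ψ ∈ A ⊗ B`. On a product vector
`ψ = a ⊗ b` it is `y ↦ ⟨y, b⟩ a`; see `one_tensor_proj_apply` for the defining property
`(1 ⊗ |y⟩⟨y|) ψ = s_ψ^{ab} y ⊗ y`. -/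
def sAB (ψ : A ⊗[ℂ] B) : B →ₗ⋆[ℂ] A where
  toFun y := TensorProduct.rid ℂ A ((innerₛₗ ℂ y).lTensor A ψ)
  map_add' x y := by rw [map_add, LinearMap.lTensor_add, LinearMap.add_apply, map_add]
  map_smul' c x := by
    rw [map_smulₛₗ, LinearMap.lTensor_smul, LinearMap.smul_apply, map_smul]

/-- The rank one operator `|v⟩⟨v|`. -/
def ketBra {E : Type*} [NormedAddCommGroup E] [InnerProductSpace ℂ E] (v : E) : E →ₗ[ℂ] E :=
  (innerₛₗ ℂ v).smulRight v

theorem proj_tensor_one_apply (ψ : A ⊗[ℂ] B) (x : A) :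
    (ketBra x).rTensor B ψ = x ⊗ₜ[ℂ] sBA ψ x := by
  simp only [sBA, LinearMap.coe_mk, AddHom.coe_mk]
  induction ψ with
  | zero => simp
  | tmul a b => simp [ketBra, TensorProduct.smul_tmul]
  | add u v hu hv => simp only [map_add, TensorProduct.tmul_add, hu, hv]

theorem one_tensor_proj_apply (ψ : A ⊗[ℂ] B) (y : B) :
    (ketBra y).lTensor A ψ = sAB ψ y ⊗ₜ[ℂ] y := by
  simp only [sAB, LinearMap.coe_mk, AddHom.coe_mk]
  induction ψ with
  | zero => simp
  | tmul a b => simp [ketBra, TensorProduct.smul_tmul]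
  | add u v hu hv => simp only [map_add, TensorProduct.add_tmul, hu, hv]

/-- The teleportation map `t^{ca} = s_φ^{cb} ∘ s_ψ^{ba} : A → C`, which is linear. -/
def tCA (ψ : A ⊗[ℂ] B) (φ : B ⊗[ℂ] C) : A →ₗ[ℂ] C :=
  (sBA φ).comp (sBA ψ)

/-- The map in the opposite direction, `t^{ac} = s_ψ^{ab} ∘ s_φ^{bc} : C → A`. -/
def tAC (ψ : A ⊗[ℂ] B) (φ : B ⊗[ℂ] C) : C →ₗ[ℂ] A :=
  (sAB ψ).comp (sAB φ)

/-- `ψ` has a Schmidt decomposition `ψ = ∑_{j<k} √p_j a_j ⊗ b_j`, with `k` positive `p_j` and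
orthonormal families `a`, `b`; that is, `k` is the Schmidt rank of `ψ`. -/
def HasSchmidtRank (ψ : A ⊗[ℂ] B) (k : ℕ) : Prop :=
  ∃ (p : Fin k → ℝ) (a : Fin k → A) (b : Fin k → B),
    (∀ j, 0 < p j) ∧ Orthonormal ℂ a ∧ Orthonormal ℂ b ∧
      ψ = ∑ j, ((Real.sqrt (p j) : ℝ) : ℂ) • (a j ⊗ₜ[ℂ] b j)

end Vectors

section PartialTrace

variable {A B : Type*}
  [NormedAddCommGroup A] [InnerProductSpace ℂ A] [FiniteDimensional ℂ A]
  [NormedAddCommGroup B] [InnerProductSpace ℂ B] [FiniteDimensional ℂ B]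

/-- The partial trace over the left factor: the linear map with `X ⊗ Y ↦ (tr X) Y`. -/
def traceLeft : (A ⊗[ℂ] B →ₗ[ℂ] A ⊗[ℂ] B) →ₗ[ℂ] (B →ₗ[ℂ] B) :=
  (TensorProduct.lid ℂ (B →ₗ[ℂ] B)).toLinearMap ∘ₗ
    (LinearMap.trace ℂ A).rTensor (B →ₗ[ℂ] B) ∘ₗ
      (homTensorHomEquiv ℂ A B A B).symm.toLinearMap

/-- The partial trace over the right factor: the linear map with `X ⊗ Y ↦ (tr Y) X`. -/
def traceRight : (A ⊗[ℂ] B →ₗ[ℂ] A ⊗[ℂ] B) →ₗ[ℂ] (A →ₗ[ℂ] A) :=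
  (TensorProduct.rid ℂ (A →ₗ[ℂ] A)).toLinearMap ∘ₗ
    (LinearMap.trace ℂ B).lTensor (A →ₗ[ℂ] A) ∘ₗ
      (homTensorHomEquiv ℂ A B A B).symm.toLinearMap

/-- The reduction of `|ψ⟩⟨ψ|` to the right factor. -/
def reducedRight (ψ : A ⊗[ℂ] B) : B →L[ℂ] B :=
  LinearMap.toContinuousLinearMap (traceLeft (ketBra ψ))

/-- The reduction of `|ψ⟩⟨ψ|` to the left factor. -/
def reducedLeft (ψ : A ⊗[ℂ] B) : A →L[ℂ] A :=
  LinearMap.toContinuousLinearMap (traceRight (ketBra ψ))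

end PartialTrace

section Operators

variable {E : Type*} [NormedAddCommGroup E] [InnerProductSpace ℂ E] [CompleteSpace E]

/-- The operator `(√ρ σ √ρ)^{1/2}` of two positive operators. -/
def fidelityOp (ρ σ : E →L[ℂ] E) : E →L[ℂ] E :=
  CFC.sqrt (CFC.sqrt ρ * σ * CFC.sqrt ρ)

theorem fidelityOp_isSymmetric (ρ σ : E →L[ℂ] E) :
    (fidelityOp ρ σ).toLinearMap.IsSymmetric := by
  have h : 0 ≤ fidelityOp ρ σ := CFC.sqrt_nonneg _
  rw [ContinuousLinearMap.nonneg_iff_isPositive] at h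
  exact h.isSymmetric

/-- The (square root) fidelity `F(ρ, σ) = tr (√ρ σ √ρ)^{1/2}` of two positive operators (this trace
is real, the operator being positive). -/
def fidelity (ρ σ : E →L[ℂ] E) : ℝ :=
  (LinearMap.trace ℂ E (fidelityOp ρ σ).toLinearMap).re

/-- The trace norm `tr (T†T)^{1/2}` (this trace is real, the operator being positive). -/
def traceNorm [FiniteDimensional ℂ E] {F : Type*} [NormedAddCommGroup F]
    [InnerProductSpace ℂ F] [FiniteDimensional ℂ F] (T : E →ₗ[ℂ] F) : ℝ :=
  (LinearMap.trace ℂ E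
    (CFC.sqrt (LinearMap.toContinuousLinearMap (LinearMap.adjoint T ∘ₗ T)) :
      E →L[ℂ] E).toLinearMap).re

end Operators

end Teleportation

end

/-! The maps `sBA` and `sAB` are antilinear adjoints (`inner_sBA_left`), so the adjoint of `tCA` is
`tAC`. They also factor the reductions: with s_ψ = `sBA ψ`, s_ψ' = `sAB ψ` (likewise for φ), ρ_ψ =
s_ψ s_ψ' and ρ_φ = s_φ' s_φ. Put M = √ρ_ψ ρ_φ √ρ_ψ and t = `tCA ψ φ`. Then f = s_ψ' ρ_φ √ρ_ψ
satisfies t†t f = f M, and g = s_φ √ρ_ψ satisfies t t† g = g M. Full Schmidt rank makes f and g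
injective, so they carry an eigenbasis of √M to bases of eigenvectors of t†t and t t†; antilinearity
is harmless because the eigenvalues are real. These bases need not be orthonormal, hence
`eigenvalues_eq_of_basis`. Summing singular values gives the trace norms. -/

/-! ### Spectra read off from arbitrary eigenbases -/

namespace LinearMap.IsSymmetric

open Polynomial in
/-- The eigenvalues of a symmetric operator can be read off from any basis of eigenvectors. -/
theorem eigenvalues_eq_of_basis {𝕜 E : Type*} [RCLike 𝕜] [NormedAddCommGroup E]
    [InnerProductSpace 𝕜 E] [FiniteDimensional 𝕜 E] {T : E →ₗ[𝕜] E} (hT : T.IsSymmetric) {n : ℕ}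
    (hn : Module.finrank 𝕜 E = n) (v : Module.Basis (Fin n) 𝕜 E) (l : Fin n → ℝ) (hl : Antitone l)
    (h : ∀ i, T (v i) = (l i : 𝕜) • v i) : hT.eigenvalues hn = l := by
  -- Without orthonormality of `v`, the comparison goes through the characteristic polynomial, which
  -- is basis independent and records multiplicities.
  have hM : LinearMap.toMatrix v v T = Matrix.diagonal (fun i => (l i : 𝕜)) := by
    ext i j
    rw [LinearMap.toMatrix_apply, h, map_smul, v.repr_self, Matrix.diagonal_apply]
    by_cases hij : i = j
    · subst hij; simp [RCLike.real_smul_eq_coe_mul]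
    · simp [hij]
  have hroots : T.charpoly.roots = Multiset.map (fun i => (l i : 𝕜)) Finset.univ.val := by
    rw [← LinearMap.charpoly_toMatrix T v, hM, Matrix.charpoly_diagonal]
    rw [Polynomial.roots_prod _ _ (by simp [Finset.prod_ne_zero_iff, Polynomial.X_sub_C_ne_zero])]
    simp
  rw [← List.ofFn_inj, ← hT.sort_roots_charpoly_eq_eigenvalues hn, hroots]
  simp_rw [Fin.univ_val_map, Multiset.map_coe, List.map_ofFn, Function.comp_def, RCLike.ofReal_re,
    Multiset.coe_sort]
  -- Both sides are decreasing lists; `l` is antitone, so sorting leaves it unchanged.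
  convert! List.mergeSort_of_pairwise ?_
  simp_rw [decide_eq_true_eq, ← List.sortedGE_iff_pairwise]
  exact hl.sortedGE_ofFn

end LinearMap.IsSymmetric

namespace LinearMap

variable {E F : Type*} [NormedAddCommGroup E] [InnerProductSpace ℂ E] [FiniteDimensional ℂ E]
  [NormedAddCommGroup F] [InnerProductSpace ℂ F] [FiniteDimensional ℂ F]

/-- The singular values of `T` can be read off from any basis of eigenvectors of `T† T`. -/
theorem singularValues_eq_of_basis (T : E →ₗ[ℂ] F) {n : ℕ} (hn : Module.finrank ℂ E = n)
    (v : Module.Basis (Fin n) ℂ E) (l : Fin n → ℝ) (hl : Antitone l) (hl0 : ∀ i, 0 ≤ l i)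
    (h : ∀ i, adjoint T (T (v i)) = ((l i : ℂ) * l i) • v i) (i : Fin n) :
    T.singularValues i = l i := by
  have := T.isSymmetric_adjoint_comp_self.eigenvalues_eq_of_basis hn v (fun i => l i * l i)
    (fun i j hij => mul_self_le_mul_self (hl0 j) (hl hij)) (fun i => by simpa using h i)
  rw [T.singularValues_fin hn, this, Real.sqrt_mul_self (hl0 i)]

end LinearMap

namespace Teleportation

/-! ### The antilinear maps of a bipartite vector -/

section Antilinear

variable {A B : Type*}
  [NormedAddCommGroup A] [InnerProductSpace ℂ A]
  [NormedAddCommGroup B] [InnerProductSpace ℂ B]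

@[simp]
theorem sBA_tmul (a : A) (b : B) (x : A) : sBA (a ⊗ₜ[ℂ] b) x = inner ℂ x a • b := by
  simp [sBA]

@[simp]
theorem sAB_tmul (a : A) (b : B) (y : B) : sAB (a ⊗ₜ[ℂ] b) y = inner ℂ y b • a := by
  simp [sAB]

theorem sBA_add (u v : A ⊗[ℂ] B) (x : A) : sBA (u + v) x = sBA u x + sBA v x := by
  simp [sBA]

theorem sAB_add (u v : A ⊗[ℂ] B) (y : B) : sAB (u + v) y = sAB u y + sAB v y := by
  simp [sAB]

@[simp]
theorem sBA_zero (x : A) : sBA (0 : A ⊗[ℂ] B) x = 0 := by simp [sBA]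

@[simp]
theorem sAB_zero (y : B) : sAB (0 : A ⊗[ℂ] B) y = 0 := by simp [sAB]

/-- The antilinear maps `s^{ba}` and `s^{ab}` are adjoint to each other. -/
theorem inner_sBA_left (ψ : A ⊗[ℂ] B) (x : A) (y : B) :
    inner ℂ (sBA ψ x) y = inner ℂ (sAB ψ y) x := by
  induction ψ with
  | zero => simp
  | tmul a b => simp [mul_comm]
  | add u v hu hv => simp only [sBA_add, sAB_add, inner_add_left, hu, hv]

theorem inner_sBA_right (ψ : A ⊗[ℂ] B) (x : A) (y : B) :
    inner ℂ y (sBA ψ x) = inner ℂ x (sAB ψ y) := by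
  rw [← inner_conj_symm, inner_sBA_left, inner_conj_symm]

/-- In the Schmidt form, independence of the `b j` forces every √p_j ⟨x, a_j⟩ to vanish, and the `a
j`, being as many as the dimension, form a basis. -/
theorem HasSchmidtRank.sBA_injective {ψ : A ⊗[ℂ] B} {d : ℕ} [FiniteDimensional ℂ A]
    (hψ : HasSchmidtRank ψ d) (hA : Module.finrank ℂ A = d) : Function.Injective (sBA ψ) := by
  obtain ⟨p, a, b, hp, ha, hb, rfl⟩ := hψ
  rw [injective_iff_map_eq_zero]
  intro x hx
  have hs : sBA (∑ j, ((Real.sqrt (p j) : ℝ) : ℂ) • (a j ⊗ₜ[ℂ] b j)) x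
      = ∑ j, (((Real.sqrt (p j) : ℝ) : ℂ) * inner ℂ x (a j)) • b j := by
    simp only [sBA, LinearMap.coe_mk, AddHom.coe_mk, map_sum, map_smul, LinearMap.rTensor_tmul,
      TensorProduct.lid_tmul, smul_smul, innerₛₗ_apply_apply]
  rw [hs] at hx
  have h0 := (Fintype.linearIndependent_iff.1 hb.linearIndependent) _ hx
  refine InnerProductSpace.ext_inner_right_basis
    (basisOfLinearIndependentOfCardEqFinrank' _ ha.linearIndependent (by simp [hA])) fun j => ?_
  rcases mul_eq_zero.1 (h0 j) with h | h
  · exact absurd h (by exact_mod_cast (Real.sqrt_pos.2 (hp j)).ne')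
  · simpa using h

theorem HasSchmidtRank.sAB_injective {ψ : A ⊗[ℂ] B} {d : ℕ} [FiniteDimensional ℂ B]
    (hψ : HasSchmidtRank ψ d) (hB : Module.finrank ℂ B = d) : Function.Injective (sAB ψ) := by
  obtain ⟨p, a, b, hp, ha, hb, rfl⟩ := hψ
  rw [injective_iff_map_eq_zero]
  intro y hy
  have hs : sAB (∑ j, ((Real.sqrt (p j) : ℝ) : ℂ) • (a j ⊗ₜ[ℂ] b j)) y
      = ∑ j, (((Real.sqrt (p j) : ℝ) : ℂ) * inner ℂ y (b j)) • a j := by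
    simp only [sAB, LinearMap.coe_mk, AddHom.coe_mk, map_sum, map_smul, LinearMap.lTensor_tmul,
      TensorProduct.rid_tmul, smul_smul, innerₛₗ_apply_apply]
  rw [hs] at hy
  have h0 := (Fintype.linearIndependent_iff.1 ha.linearIndependent) _ hy
  refine InnerProductSpace.ext_inner_right_basis
    (basisOfLinearIndependentOfCardEqFinrank' _ hb.linearIndependent (by simp [hB])) fun j => ?_
  rcases mul_eq_zero.1 (h0 j) with h | h
  · exact absurd h (by exact_mod_cast (Real.sqrt_pos.2 (hp j)).ne')
  · simpa using h

end Antilinear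

/-! ### Reductions as products of antilinear maps -/

section PartialTrace

variable {A B : Type*}
  [NormedAddCommGroup A] [InnerProductSpace ℂ A] [FiniteDimensional ℂ A]
  [NormedAddCommGroup B] [InnerProductSpace ℂ B] [FiniteDimensional ℂ B]

theorem homTensorHomEquiv_symm_smulRight_tmul (a a' : A) (b b' : B) :
    (homTensorHomEquiv ℂ A B A B).symm
        ((innerₛₗ ℂ (a' ⊗ₜ[ℂ] b')).smulRight (a ⊗ₜ[ℂ] b)) =
      (innerₛₗ ℂ a').smulRight a ⊗ₜ[ℂ] (innerₛₗ ℂ b').smulRight b := by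
  rw [LinearEquiv.symm_apply_eq, homTensorHomEquiv_apply]
  ext x y
  simp [← TensorProduct.smul_tmul_smul]

/-- The partial trace over the left factor of `|u⟩⟨v|` is `s_u^{ba} s_v^{ab}`. -/
theorem traceLeft_smulRight (u v : A ⊗[ℂ] B) :
    traceLeft ((innerₛₗ ℂ v).smulRight u) = (sBA u).comp (sAB v) := by
  -- Separating `u` from `v` makes the claim additive in each, which |ψ⟩⟨ψ| is not in ψ; product
  -- vectors then suffice.
  induction u with
  | zero => ext y; simp
  | add u₁ u₂ h₁ h₂ =>
    have : (innerₛₗ ℂ v).smulRight (u₁ + u₂) =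
        (innerₛₗ ℂ v).smulRight u₁ + (innerₛₗ ℂ v).smulRight u₂ := by ext; simp
    rw [this, map_add, h₁, h₂]
    ext y; simp [sBA_add]
  | tmul a b =>
    induction v with
    | zero => ext y; simp
    | add v₁ v₂ h₁ h₂ =>
      have : (innerₛₗ ℂ (v₁ + v₂)).smulRight (a ⊗ₜ[ℂ] b) =
          (innerₛₗ ℂ v₁).smulRight (a ⊗ₜ[ℂ] b) + (innerₛₗ ℂ v₂).smulRight (a ⊗ₜ[ℂ] b) := by
        ext; simp [add_smul]
      rw [this, map_add, h₁, h₂]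
      ext y; simp [sAB_add, add_smul]
    | tmul a' b' =>
      ext y
      simp [traceLeft, homTensorHomEquiv_symm_smulRight_tmul, smul_smul, mul_comm]

/-- The partial trace over the right factor of `|u⟩⟨v|` is `s_u^{ab} s_v^{ba}`. -/
theorem traceRight_smulRight (u v : A ⊗[ℂ] B) :
    traceRight ((innerₛₗ ℂ v).smulRight u) = (sAB u).comp (sBA v) := by
  induction u with
  | zero => ext y; simp
  | add u₁ u₂ h₁ h₂ =>
    have : (innerₛₗ ℂ v).smulRight (u₁ + u₂) =
        (innerₛₗ ℂ v).smulRight u₁ + (innerₛₗ ℂ v).smulRight u₂ := by ext; simp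
    rw [this, map_add, h₁, h₂]
    ext y; simp [sAB_add]
  | tmul a b =>
    induction v with
    | zero => ext y; simp
    | add v₁ v₂ h₁ h₂ =>
      have : (innerₛₗ ℂ (v₁ + v₂)).smulRight (a ⊗ₜ[ℂ] b) =
          (innerₛₗ ℂ v₁).smulRight (a ⊗ₜ[ℂ] b) + (innerₛₗ ℂ v₂).smulRight (a ⊗ₜ[ℂ] b) := by
        ext; simp [add_smul]
      rw [this, map_add, h₁, h₂]
      ext y; simp [sBA_add, add_smul]
    | tmul a' b' =>
      ext y
      simp [traceRight, homTensorHomEquiv_symm_smulRight_tmul, smul_smul, mul_comm]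

theorem reducedRight_apply (ψ : A ⊗[ℂ] B) (y : B) : reducedRight ψ y = sBA ψ (sAB ψ y) :=
  LinearMap.congr_fun (traceLeft_smulRight ψ ψ) y

theorem reducedLeft_apply (ψ : A ⊗[ℂ] B) (x : A) : reducedLeft ψ x = sAB ψ (sBA ψ x) :=
  LinearMap.congr_fun (traceRight_smulRight ψ ψ) x

theorem reducedRight_nonneg [CompleteSpace B] (ψ : A ⊗[ℂ] B) : 0 ≤ reducedRight ψ := by
  rw [ContinuousLinearMap.nonneg_iff_isPositive, ContinuousLinearMap.isPositive_iff_complex]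
  intro y
  rw [reducedRight_apply, inner_sBA_left]
  simp [inner_self_eq_norm_sq_to_K, ← Complex.ofReal_pow]

theorem reducedLeft_nonneg [CompleteSpace A] (ψ : A ⊗[ℂ] B) : 0 ≤ reducedLeft ψ := by
  rw [ContinuousLinearMap.nonneg_iff_isPositive, ContinuousLinearMap.isPositive_iff_complex]
  intro x
  rw [reducedLeft_apply, ← inner_sBA_left]
  simp [inner_self_eq_norm_sq_to_K, ← Complex.ofReal_pow]

end PartialTrace

/-! ### Fidelity and trace norm as spectral sums -/

section Operators

variable {E : Type*} [NormedAddCommGroup E] [InnerProductSpace ℂ E] [CompleteSpace E]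

theorem fidelityOp_apply_apply {ρ σ : E →L[ℂ] E} (hσ : 0 ≤ σ) (x : E) :
    fidelityOp ρ σ (fidelityOp ρ σ x) = CFC.sqrt ρ (σ (CFC.sqrt ρ x)) := by
  have h0 : 0 ≤ CFC.sqrt ρ * σ * CFC.sqrt ρ :=
    (CFC.sqrt_nonneg ρ).isSelfAdjoint.conjugate_nonneg hσ
  exact DFunLike.congr_fun (CFC.sqrt_mul_sqrt_self _ h0) x

theorem fidelity_eq_sum_eigenvalues [FiniteDimensional ℂ E] (ρ σ : E →L[ℂ] E) {n : ℕ}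
    (hn : Module.finrank ℂ E = n) :
    fidelity ρ σ = ∑ i, (fidelityOp_isSymmetric ρ σ).eigenvalues hn i :=
  (fidelityOp_isSymmetric ρ σ).re_trace_eq_sum_eigenvalues hn

variable [FiniteDimensional ℂ E]

/-- The trace norm is the sum of the singular values. -/
theorem traceNorm_eq_sum_singularValues {F : Type*} [NormedAddCommGroup F]
    [InnerProductSpace ℂ F] [FiniteDimensional ℂ F] (T : E →ₗ[ℂ] F) {n : ℕ}
    (hn : Module.finrank ℂ E = n) :
    traceNorm T = ∑ i : Fin n, T.singularValues i := by
  set R : E →L[ℂ] E := LinearMap.toContinuousLinearMap (LinearMap.adjoint T ∘ₗ T) with hR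
  have hR0 : 0 ≤ R := by
    rw [ContinuousLinearMap.nonneg_iff_isPositive, ContinuousLinearMap.isPositive_iff_complex]
    intro x
    simp [hR, LinearMap.adjoint_inner_left, inner_self_eq_norm_sq_to_K, ← Complex.ofReal_pow]
  have hS : (CFC.sqrt R).toLinearMap.IsPositive := by
    have h := CFC.sqrt_nonneg R
    rw [ContinuousLinearMap.nonneg_iff_isPositive] at h
    exact h.toLinearMap
  refine (hS.isSymmetric.re_trace_eq_sum_eigenvalues hn).trans (Finset.sum_congr rfl fun i _ => ?_)
  -- An eigenbasis of √(T†T) is one of T†T with squared eigenvalues.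
  refine (T.singularValues_eq_of_basis hn (hS.isSymmetric.eigenvectorBasis hn).toBasis _
    (hS.isSymmetric.eigenvalues_antitone hn) (fun i => hS.nonneg_eigenvalues hn i)
    (fun j => ?_) i).symm
  have hj := hS.isSymmetric.apply_eigenvectorBasis hn j
  have hRj := DFunLike.congr_fun (CFC.sqrt_mul_sqrt_self R hR0)
    (hS.isSymmetric.eigenvectorBasis hn j)
  simp only [ContinuousLinearMap.coe_coe] at hj
  rw [mul_apply_eq_comp, hj, map_smul, hj, smul_smul] at hRj
  simpa [hR] using hRj.symm

end Operators

end Teleportation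
namespace Teleportation
-- Intertwining the teleportation maps with the fidelity operator
section Teleport

variable {A B C : Type*}
    [NormedAddCommGroup A] [InnerProductSpace ℂ A]
    [NormedAddCommGroup B] [InnerProductSpace ℂ B]
    [NormedAddCommGroup C] [InnerProductSpace ℂ C]

theorem adjoint_tCA [FiniteDimensional ℂ A] [FiniteDimensional ℂ C]
    (ψ : A ⊗[ℂ] B) (φ : B ⊗[ℂ] C) : LinearMap.adjoint (tCA ψ φ) = tAC ψ φ := by
  symm
  rw [LinearMap.eq_adjoint_iff]
  intro z x
  change inner ℂ (sAB ψ (sAB φ z)) x = inner ℂ z (sBA φ (sBA ψ x))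
  rw [inner_sBA_right, inner_sBA_left]

/-- An injective antilinear map sends a basis to a basis of any space of the same dimension. -/
theorem exists_basis_of_injective [FiniteDimensional ℂ A] {n : ℕ} (hn : Module.finrank ℂ A = n)
    (e : Module.Basis (Fin n) ℂ B) (f : B →ₗ⋆[ℂ] A) (hf : Function.Injective f) :
    ∃ v : Module.Basis (Fin n) ℂ A, ∀ i, v i = f (e i) := by
  have hli : LinearIndependent ℂ (fun i => f (e i)) := by
    refine e.linearIndependent.map_of_injective_injective (starRingEnd ℂ) f.toAddMonoidHom
      (fun r hr => by simpa using hr) (fun m hm => (injective_iff_map_eq_zero f).1 hf m hm)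
      fun r m => ?_
    simp
  exact ⟨basisOfLinearIndependentOfCardEqFinrank' _ hli (by simp [hn]), fun i => by simp⟩

variable [FiniteDimensional ℂ A] [FiniteDimensional ℂ B] [CompleteSpace B] [FiniteDimensional ℂ C]

theorem sqrt_reducedRight_apply_apply (ψ : A ⊗[ℂ] B) (x : B) :
    CFC.sqrt (reducedRight ψ) (CFC.sqrt (reducedRight ψ) x) = sBA ψ (sAB ψ x) := by
  rw [← reducedRight_apply]
  exact DFunLike.congr_fun (CFC.sqrt_mul_sqrt_self _ (reducedRight_nonneg ψ)) x

theorem sqrt_reducedRight_injective {ψ : A ⊗[ℂ] B} (h₁ : Function.Injective (sBA ψ))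
    (h₂ : Function.Injective (sAB ψ)) :
    Function.Injective (CFC.sqrt (reducedRight ψ) : B →L[ℂ] B) := by
  intro x y h
  apply h₂
  apply h₁
  rw [← sqrt_reducedRight_apply_apply, h, sqrt_reducedRight_apply_apply]

/-- If `(√ρ_ψ ρ_φ √ρ_ψ) x = μ x` with `μ` real, the image of `x` under
`s_ψ^{ab} ρ_φ √ρ_ψ` satisfies the eigenvalue equation of `t^{ac} t^{ca}`. -/
theorem tAC_tCA_apply (ψ : A ⊗[ℂ] B) (φ : B ⊗[ℂ] C) (x : B) (μ : ℂ) (hμ : starRingEnd ℂ μ = μ)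
    (hx : CFC.sqrt (reducedRight ψ) (reducedLeft φ (CFC.sqrt (reducedRight ψ) x)) = μ • x) :
    tAC ψ φ (tCA ψ φ (sAB ψ (reducedLeft φ (CFC.sqrt (reducedRight ψ) x)))) =
      μ • sAB ψ (reducedLeft φ (CFC.sqrt (reducedRight ψ) x)) := by
  change sAB ψ (sAB φ (sBA φ (sBA ψ (sAB ψ _)))) = _
  -- Writing s_ψ s_ψ' as √ρ_ψ √ρ_ψ exposes M acting on `x`; `hμ` undoes the conjugation of `μ` by
  -- `sAB ψ`.
  rw [← sqrt_reducedRight_apply_apply, ← reducedLeft_apply, hx, map_smul, map_smul, map_smulₛₗ, hμ]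

/-- If `(√ρ_ψ ρ_φ √ρ_ψ) x = μ x` with `μ` real, the image of `x` under `s_φ^{cb} √ρ_ψ` satisfies
the eigenvalue equation of `t^{ca} t^{ac}`. -/
theorem tCA_tAC_apply (ψ : A ⊗[ℂ] B) (φ : B ⊗[ℂ] C) (x : B) (μ : ℂ) (hμ : starRingEnd ℂ μ = μ)
    (hx : CFC.sqrt (reducedRight ψ) (reducedLeft φ (CFC.sqrt (reducedRight ψ) x)) = μ • x) :
    tCA ψ φ (tAC ψ φ (sBA φ (CFC.sqrt (reducedRight ψ) x))) =
      μ • sBA φ (CFC.sqrt (reducedRight ψ) x) := by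
  change sBA φ (sBA ψ (sAB ψ (sAB φ (sBA φ _)))) = _
  rw [← reducedLeft_apply, ← sqrt_reducedRight_apply_apply, hx, map_smul, map_smulₛₗ, hμ]

theorem fidelityOp_nonneg_eigenvalues (ρ σ : B →L[ℂ] B) {n : ℕ} (hn : Module.finrank ℂ B = n)
    (i : Fin n) : 0 ≤ (fidelityOp_isSymmetric ρ σ).eigenvalues hn i := by
  have h : 0 ≤ fidelityOp ρ σ := CFC.sqrt_nonneg _
  rw [ContinuousLinearMap.nonneg_iff_isPositive] at h
  exact h.toLinearMap.nonneg_eigenvalues hn i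

theorem sqrt_mul_mul_sqrt_apply_eigenvectorBasis {ρ σ : B →L[ℂ] B} (hσ : 0 ≤ σ) {n : ℕ}
    (hn : Module.finrank ℂ B = n) (i : Fin n) :
    CFC.sqrt ρ (σ (CFC.sqrt ρ ((fidelityOp_isSymmetric ρ σ).eigenvectorBasis hn i))) =
      (((fidelityOp_isSymmetric ρ σ).eigenvalues hn i : ℂ) *
        (fidelityOp_isSymmetric ρ σ).eigenvalues hn i) •
          (fidelityOp_isSymmetric ρ σ).eigenvectorBasis hn i := by
  have h := (fidelityOp_isSymmetric ρ σ).apply_eigenvectorBasis hn i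
  simp only [ContinuousLinearMap.coe_coe] at h
  rw [← fidelityOp_apply_apply hσ, h, map_smul, h, smul_smul]
  rfl

theorem singularValues_tCA {d : ℕ} (hA : Module.finrank ℂ A = d) (hB : Module.finrank ℂ B = d)
    {ψ : A ⊗[ℂ] B} {φ : B ⊗[ℂ] C} (hC : Module.finrank ℂ C = d)
    (hψ : HasSchmidtRank ψ d) (hφ : HasSchmidtRank φ d) (i : Fin d) :
    (tCA ψ φ).singularValues i =
      (fidelityOp_isSymmetric (reducedRight ψ) (reducedLeft φ)).eigenvalues hB i := by
  set hM := fidelityOp_isSymmetric (reducedRight ψ) (reducedLeft φ)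
  let f : B →ₗ⋆[ℂ] A :=
    (sAB ψ).comp ((reducedLeft φ).toLinearMap.comp (CFC.sqrt (reducedRight ψ)).toLinearMap)
  have hσ : Function.Injective (reducedLeft φ) := fun x y h =>
    hφ.sBA_injective hB (hφ.sAB_injective hC (by rwa [reducedLeft_apply, reducedLeft_apply] at h))
  have hf : Function.Injective f := (hψ.sAB_injective hB).comp (hσ.comp
    (sqrt_reducedRight_injective (hψ.sBA_injective hA) (hψ.sAB_injective hB)))
  obtain ⟨v, hv⟩ := exists_basis_of_injective hA (hM.eigenvectorBasis hB).toBasis f hf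
  refine (tCA ψ φ).singularValues_eq_of_basis hA v _ (hM.eigenvalues_antitone hB)
    (fidelityOp_nonneg_eigenvalues _ _ hB) (fun j => ?_) i
  rw [hv, adjoint_tCA, OrthonormalBasis.coe_toBasis]
  exact tAC_tCA_apply ψ φ _ _ (by simp)
    (sqrt_mul_mul_sqrt_apply_eigenvectorBasis (reducedLeft_nonneg φ) hB j)

theorem singularValues_tAC {d : ℕ} (hA : Module.finrank ℂ A = d) (hB : Module.finrank ℂ B = d)
    {ψ : A ⊗[ℂ] B} {φ : B ⊗[ℂ] C} (hC : Module.finrank ℂ C = d)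
    (hψ : HasSchmidtRank ψ d) (hφ : HasSchmidtRank φ d) (i : Fin d) :
    (tAC ψ φ).singularValues i =
      (fidelityOp_isSymmetric (reducedRight ψ) (reducedLeft φ)).eigenvalues hB i := by
  set hM := fidelityOp_isSymmetric (reducedRight ψ) (reducedLeft φ)
  -- No factor ρ_φ is needed here: t t† ends with s_φ', which combines with the s_φ in `f` to give
  -- it.
  let f : B →ₗ⋆[ℂ] C := (sBA φ).comp (CFC.sqrt (reducedRight ψ)).toLinearMap
  have hf : Function.Injective f := (hφ.sBA_injective hB).comp
    (sqrt_reducedRight_injective (hψ.sBA_injective hA) (hψ.sAB_injective hB))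
  obtain ⟨v, hv⟩ := exists_basis_of_injective hC (hM.eigenvectorBasis hB).toBasis f hf
  refine (tAC ψ φ).singularValues_eq_of_basis hC v _ (hM.eigenvalues_antitone hB)
    (fidelityOp_nonneg_eigenvalues _ _ hB) (fun j => ?_) i
  rw [hv, ← adjoint_tCA, LinearMap.adjoint_adjoint, adjoint_tCA, OrthonormalBasis.coe_toBasis]
  exact tCA_tAC_apply ψ φ _ _ (by simp)
    (sqrt_mul_mul_sqrt_apply_eigenvectorBasis (reducedLeft_nonneg φ) hB j)

end Teleport

end Teleportation

theorem mainTheorem9 {A B C : Type*}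
    [NormedAddCommGroup A] [InnerProductSpace ℂ A] [FiniteDimensional ℂ A] [CompleteSpace A]
    [NormedAddCommGroup B] [InnerProductSpace ℂ B] [FiniteDimensional ℂ B] [CompleteSpace B]
    [NormedAddCommGroup C] [InnerProductSpace ℂ C] [FiniteDimensional ℂ C] [CompleteSpace C]
    (d : ℕ) (hA : Module.finrank ℂ A = d) (hB : Module.finrank ℂ B = d)
    (hC : Module.finrank ℂ C = d)
    (ψ : A ⊗[ℂ] B) (φ : B ⊗[ℂ] C)
    (hψ : Teleportation.HasSchmidtRank ψ d) (hφ : Teleportation.HasSchmidtRank φ d) :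
    LinearMap.adjoint (Teleportation.tCA ψ φ) = Teleportation.tAC ψ φ ∧
    (∀ i : Fin d, (Teleportation.tCA ψ φ).singularValues i =
      (Teleportation.fidelityOp_isSymmetric (Teleportation.reducedRight ψ)
        (Teleportation.reducedLeft φ)).eigenvalues hB i) ∧
    (∀ i : Fin d, (Teleportation.tAC ψ φ).singularValues i =
      (Teleportation.fidelityOp_isSymmetric (Teleportation.reducedRight ψ)
        (Teleportation.reducedLeft φ)).eigenvalues hB i) ∧
    Teleportation.traceNorm (Teleportation.tCA ψ φ) =
      Teleportation.fidelity (Teleportation.reducedRight ψ) (Teleportation.reducedLeft φ) ∧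
    Teleportation.traceNorm (Teleportation.tAC ψ φ) =
      Teleportation.fidelity (Teleportation.reducedRight ψ) (Teleportation.reducedLeft φ) := by
  have hCA := Teleportation.singularValues_tCA hA hB hC hψ hφ
  have hAC := Teleportation.singularValues_tAC hA hB hC hψ hφ
  refine ⟨Teleportation.adjoint_tCA ψ φ, hCA, hAC, ?_, ?_⟩
  · rw [Teleportation.traceNorm_eq_sum_singularValues _ hA,
      Teleportation.fidelity_eq_sum_eigenvalues _ _ hB]
    exact Finset.sum_congr rfl fun i _ => hCA i
  · rw [Teleportation.traceNorm_eq_sum_singularValues _ hC,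
      Teleportation.fidelity_eq_sum_eigenvalues _ _ hB]
    exact Finset.sum_congr rfl fun i _ => hAC i
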